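/- A \emph{market} consists of a finite set $I$ of agents, a finite set $\Omega$ of trades, each with a buyer and a distinct seller in $I$, and for every agent $i$ a valuation $v^i$ that assigns to every set of trades involving $i$ a value in $\mathbb{Z}\cup\{-\infty\}$, with $v^i(\emptyset)=0$. For $\Phi\subseteq\Omega$ let $\Phi_i$ be the set of trades in $\Phi$ that involve $i$ (those that $i$ buys or sells), and put $\chi^i_\omega=1$ if $i$ is the buyer of $\omega$, $\chi^i_\omega=-1$ if $i$ is the seller, and $\chi^i_\omega=0$ otherwise. The utility of $i$ from a bundle $\Psi\subseteq\Omega_i$ at prices $p$ is $u^i(\Psi,p)=v^i(\Psi)-\sum_{\omega\in\Psi}\chi^i_\omega p_\omega$, and $D^i(p)$ is the set of bundles $\Psi\subseteq\Omega_i$ that maximize it. The \emph{market value} is $\max_{\Phi\subseteq\Omega}\sum_{i\in I}v^i(\Phi_i)$, and $\Phi$ is \emph{efficient} if it attains this maximum. An agent is \emph{essential} if it is involved in at least one trade of every efficient set of trades. For $C\subseteq I$ let $w(C)=\max_{\Phi}\sum_{i\in C}v^i(\Phi_i)$, where $\Phi$ ranges over the sets of trades whose buyer and seller both belong to $C$.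 The \emph{core of the cooperative market game} is the set of $x\in\mathbb{R}_{\ge 0}^I$ with $\sum_{i\in I}x_i=w(I)$ and $\sum_{i\in C}x_i\ge w(C)$ for all $C\subsetneq I$. A \emph{market outcome} $(p,\Phi)$ consists of a set $\Phi\subseteq\Omega$ of trades and prices $p\in\mathbb{R}^{\Phi}$. The \emph{core of market outcomes} consists of the outcomes $(p,\Phi)$ that are individually rational, i.e. $u^i(\Phi_i,p)\ge 0$ for all $i\in I$, and for which there is no outcome $(q,\Psi)$ with $u^i(\Psi_i,q)\ge u^i(\Phi_i,p)$ for all agents $i$ involved in at least one trade of $\Psi$ and with strict inequality for at least one of them. The market is a \emph{substitutes market} if every agent $i$ is fully substitutable, i.e. for all $p,p'\in\mathbb{R}^\Omega$ and every $\Psi\in D^i(p)$: (i) if $p=p'$ on the trades that $i$ sells and $p\ge p'$ on the trades that $i$ buys, then there is $\Psi'\in D^i(p')$ such that every trade $\omega\in\Psi'$ that $i$ buys with $p_\omega=p'_\omega$ is in $\Psi$, and every trade in $\Psi$ that $i$ sells is in $\Psi'$; (ii) if $p=p'$ on the trades that $i$ buys and $p\le p'$ on the trades that $i$ sells, then there is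 $\Psi'\in D^i(p')$ such that every trade $\omega\in\Psi'$ that $i$ sells with $p_\omega=p'_\omega$ is in $\Psi$, and every trade in $\Psi$ that $i$ buys is in $\Psi'$. \textbf{Corollary.} Consider a market with positive market value. If the core of its cooperative market game is non-empty, or if its core of market outcomes is non-empty, then the market has at least one essential agent. In particular, if it is a substitutes market, then both cores are non-empty and the market has at least one essential agent. -/

import Mathlib

/-- A trading network market with agents `I` and bilateral trades `Ω`. Every trade has a buyer and
a distinct seller. `val i Ψ` is the value, an integer or `-∞` (written `⊥`), of agent `i` for the
bundle `Ψ`; it is only ever evaluated at bundles of trades that involve `i`. -/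
structure TradingMarket (I Ω : Type*) where
  buyer : Ω → I
  seller : Ω → I
  buyer_ne_seller : ∀ ω, buyer ω ≠ seller ω
  val : I → Finset Ω → WithBot ℤ
  val_empty : ∀ i, val i ∅ = 0

namespace TradingMarket

noncomputable section

variable {I Ω : Type*} [Fintype I] [DecidableEq I] [Fintype Ω] [DecidableEq Ω]

/-- The trades of `Ψ` in which `i` is the buyer. -/
def buying (M : TradingMarket I Ω) (i : I) (Ψ : Finset Ω) : Finset Ω :=
  Ψ.filter fun ω => M.buyer ω = i

/-- The trades of `Ψ` in which `i` is the seller. -/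
def selling (M : TradingMarket I Ω) (i : I) (Ψ : Finset Ω) : Finset Ω :=
  Ψ.filter fun ω => M.seller ω = i

/-- `Ψ_i`: the trades of `Ψ` that involve `i`. -/
def tradesOf (M : TradingMarket I Ω) (i : I) (Ψ : Finset Ω) : Finset Ω :=
  Ψ.filter fun ω => M.buyer ω = i ∨ M.seller ω = i

/-- `a(Ψ)`: the agents that are involved in at least one trade of `Ψ`. -/
def agents (M : TradingMarket I Ω) (Ψ : Finset Ω) : Finset I :=
  Finset.univ.filter fun i => ∃ ω ∈ Ψ, M.buyer ω = i ∨ M.seller ω = i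

/-- `χ^i_ω`: `1` if `i` buys in `ω`, `-1` if `i` sells in `ω`, and `0` otherwise. -/
def sign (M : TradingMarket I Ω) (i : I) (ω : Ω) : ℝ :=
  if M.buyer ω = i then 1 else if M.seller ω = i then -1 else 0

/-- The valuation `v^i`, with values in `ℝ ∪ {-∞}`. -/
def value (M : TradingMarket I Ω) (i : I) (Ψ : Finset Ω) : WithBot ℝ :=
  (M.val i Ψ).map (fun z : ℤ => (z : ℝ))

/-- The quasi-linear utility `u^i(Ψ, p)` of a bundle `Ψ` of trades that involve `i`. -/
def utility (M : TradingMarket I Ω) (i : I) (Ψ : Finset Ω) (p : Ω → ℝ) : WithBot ℝ :=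
  M.value i Ψ + ((-∑ ω ∈ Ψ, M.sign i ω * p ω : ℝ) : WithBot ℝ)

/-- The demand `D^i(p)`: the bundles of trades involving `i` that maximize utility at `p`. -/
def demand (M : TradingMarket I Ω) (i : I) (p : Ω → ℝ) : Set (Finset Ω) :=
  {Ψ | Ψ ⊆ M.tradesOf i Finset.univ ∧
    ∀ Ψ' ⊆ M.tradesOf i Finset.univ, M.utility i Ψ' p ≤ M.utility i Ψ p}

/-- Full substitutability of the demand of agent `i`. -/
def FullySubstitutable (M : TradingMarket I Ω) (i : I) : Prop :=
  (∀ p p' : Ω → ℝ,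
    (∀ ω, M.seller ω = i → p ω = p' ω) → (∀ ω, M.buyer ω = i → p' ω ≤ p ω) →
    ∀ Ψ ∈ M.demand i p, ∃ Ψ' ∈ M.demand i p',
      (∀ ω ∈ M.buying i Ψ', p ω = p' ω → ω ∈ M.buying i Ψ) ∧
      M.selling i Ψ ⊆ M.selling i Ψ') ∧
  (∀ p p' : Ω → ℝ,
    (∀ ω, M.buyer ω = i → p ω = p' ω) → (∀ ω, M.seller ω = i → p ω ≤ p' ω) →
    ∀ Ψ ∈ M.demand i p, ∃ Ψ' ∈ M.demand i p',
      (∀ ω ∈ M.selling i Ψ', p ω = p' ω → ω ∈ M.selling i Ψ) ∧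
      M.buying i Ψ ⊆ M.buying i Ψ')

/-- A substitutes market: every agent is fully substitutable. -/
def IsSubstitutes (M : TradingMarket I Ω) : Prop :=
  ∀ i, M.FullySubstitutable i

/-- The social welfare of the feasible allocation given by the set of trades `Φ`. -/
def welfare (M : TradingMarket I Ω) (Φ : Finset Ω) : WithBot ℝ :=
  ∑ i, M.value i (M.tradesOf i Φ)

/-- The market value: the maximum of the social welfare over all sets of trades. -/
def marketValue (M : TradingMarket I Ω) : WithBot ℝ :=
  (Finset.univ : Finset (Finset Ω)).sup M.welfare

def IsEfficient (M : TradingMarket I Ω) (Φ : Finset Ω) : Prop :=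
  M.welfare Φ = M.marketValue

/-- An agent is essential if it is involved in every efficient set of trades. -/
def IsEssential (M : TradingMarket I Ω) (i : I) : Prop :=
  ∀ Φ, M.IsEfficient Φ → i ∈ M.agents Φ

/-- `Ω_C`: the trades whose buyer and seller both belong to `C`. -/
def tradesWithin (M : TradingMarket I Ω) (C : Finset I) : Finset Ω :=
  Finset.univ.filter fun ω => M.buyer ω ∈ C ∧ M.seller ω ∈ C

/-- The characteristic function `w` of the cooperative market game. -/
def charFun (M : TradingMarket I Ω) (C : Finset I) : WithBot ℝ :=
  (M.tradesWithin C).powerset.sup fun Φ => ∑ i ∈ C, M.value i (M.tradesOf i Φ)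

/-- The core of the cooperative market game, a set of utility imputations. -/
def gameCore (M : TradingMarket I Ω) : Set (I → ℝ) :=
  {x | (∀ i, 0 ≤ x i) ∧
    ((∑ i, x i : ℝ) : WithBot ℝ) = M.charFun Finset.univ ∧
    ∀ C : Finset I, C ⊂ Finset.univ → M.charFun C ≤ ((∑ i ∈ C, x i : ℝ) : WithBot ℝ)}

/-- A market outcome: a set of trades, and prices for these trades only. -/
structure Outcome (Ω : Type*) where
  trades : Finset Ω
  price : {ω // ω ∈ trades} → ℝ

/-- The utility of agent `i` in a market outcome. The coefficient `sign i ω` vanishes at the trades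
that do not involve `i`, so that the sum is the net payment of `i`. -/
def outcomeUtility (M : TradingMarket I Ω) (i : I) (o : Outcome Ω) : WithBot ℝ :=
  M.value i (M.tradesOf i o.trades) +
    ((-∑ ω : {ω // ω ∈ o.trades}, M.sign i ω.1 * o.price ω : ℝ) : WithBot ℝ)

/-- The outcome `o'` blocks `o`: all agents involved in `o'` are at least as well off as in `o`,
and one of them is strictly better off. -/
def Blocks (M : TradingMarket I Ω) (o' o : Outcome Ω) : Prop :=
  (∀ i ∈ M.agents o'.trades, M.outcomeUtility i o ≤ M.outcomeUtility i o') ∧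
    ∃ i ∈ M.agents o'.trades, M.outcomeUtility i o < M.outcomeUtility i o'

/-- The core of market outcomes: the individually rational outcomes that no outcome blocks. -/
def outcomeCore (M : TradingMarket I Ω) : Set (Outcome Ω) :=
  {o | (∀ i, 0 ≤ M.outcomeUtility i o) ∧ ¬ ∃ o', M.Blocks o' o}

end

end TradingMarket

set_option linter.unusedSectionVars false

namespace TradingMarket

noncomputable section

variable {I Ω : Type*} [Fintype I] [DecidableEq I] [Fintype Ω] [DecidableEq Ω]

/-! If some efficient set of trades avoids agent `i`, the other agents generate the whole market
value without `i`, so every vector in the game core gives `i` at most `0`. Without essential agents,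
all core payoffs would be nonpositive, although they add up to a positive market value.

The two cores are nonempty together. Prices move money only along trades, hence only within a
connected component of the executed trades, but inside a component every zero-sum transfer is
possible (`exists_transfer`). An imputation that violates a coalition constraint therefore yields a
blocking outcome on one component with positive surplus. Conversely, in an efficient set of trades a
game-core vector leaves every component with surplus zero, so prices can implement it.

For substitutes markets, each trade is treated as an object for which its buyer and seller compete:
the buyer holds it by executing it, the seller by not executing it. The holder faces the lower of
two prices, which differ by at most `δ`. Full substitutability keeps held trades held while prices
rise (`AuctionState.exists_buyer_bid`, `AuctionState.exists_seller_bid`), nonnegative utilities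
bound the prices (`AuctionState.price_le`), and the auction stops at an approximate equilibrium. Its
utilities satisfy the core inequalities up to `ε` (`exists_approx_core`), and compactness gives an
exact core vector in the limit. -/

/-- The valuation as a real number, with the value `0` at infeasible bundles. -/
def realVal (M : TradingMarket I Ω) (i : I) (Ψ : Finset Ω) : ℝ :=
  (((M.val i Ψ).unbotD 0 : ℤ) : ℝ)

/-- The net payment of agent `i` for the bundle `Ψ` at prices `p`. -/
def payment (M : TradingMarket I Ω) (i : I) (Ψ : Finset Ω) (p : Ω → ℝ) : ℝ :=
  ∑ ω ∈ Ψ, M.sign i ω * p ω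

variable (M : TradingMarket I Ω)

/-! ### Reduction of values in `WithBot ℝ` to real inequalities over feasible bundles -/

theorem value_eq_coe {i : I} {Ψ : Finset Ω} (h : M.val i Ψ ≠ ⊥) :
    M.value i Ψ = ((M.realVal i Ψ : ℝ) : WithBot ℝ) := by
  obtain ⟨z, hz⟩ := WithBot.ne_bot_iff_exists.1 h
  simp [value, realVal, ← hz]

theorem value_eq_bot_iff {i : I} {Ψ : Finset Ω} : M.value i Ψ = ⊥ ↔ M.val i Ψ = ⊥ := by
  simp [value]

theorem realVal_empty (i : I) : M.realVal i ∅ = 0 := by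
  simp [realVal, M.val_empty]

theorem val_empty_ne_bot (i : I) : M.val i ∅ ≠ ⊥ := by
  simp [M.val_empty]

theorem sum_value_eq_coe {C : Finset I} {Θ : I → Finset Ω} (h : ∀ i ∈ C, M.val i (Θ i) ≠ ⊥) :
    ∑ i ∈ C, M.value i (Θ i) = ((∑ i ∈ C, M.realVal i (Θ i) : ℝ) : WithBot ℝ) := by
  rw [WithBot.coe_sum]
  exact Finset.sum_congr rfl fun i hi => M.value_eq_coe (h i hi)

theorem sum_value_le_coe_iff {C : Finset I} {Θ : I → Finset Ω} {x : ℝ} :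
    ∑ i ∈ C, M.value i (Θ i) ≤ (x : WithBot ℝ) ↔
      ((∀ i ∈ C, M.val i (Θ i) ≠ ⊥) → ∑ i ∈ C, M.realVal i (Θ i) ≤ x) := by
  by_cases h : ∀ i ∈ C, M.val i (Θ i) ≠ ⊥
  · rw [M.sum_value_eq_coe h, WithBot.coe_le_coe]
    exact ⟨fun h' _ => h', fun h' => h' h⟩
  · have h' : ∑ i ∈ C, M.value i (Θ i) = ⊥ := by
      push Not at h
      obtain ⟨i, hi, hb⟩ := h
      exact WithBot.sum_eq_bot_iff.2 ⟨i, hi, M.value_eq_bot_iff.2 hb⟩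
    simp [h', h]

theorem charFun_le_coe_iff {C : Finset I} {x : ℝ} :
    M.charFun C ≤ (x : WithBot ℝ) ↔
      ∀ Φ ⊆ M.tradesWithin C, (∀ i ∈ C, M.val i (M.tradesOf i Φ) ≠ ⊥) →
        ∑ i ∈ C, M.realVal i (M.tradesOf i Φ) ≤ x := by
  simp only [charFun, Finset.sup_le_iff, Finset.mem_powerset, M.sum_value_le_coe_iff]

theorem mem_tradesWithin {C : Finset I} {ω : Ω} :
    ω ∈ M.tradesWithin C ↔ M.buyer ω ∈ C ∧ M.seller ω ∈ C := by
  simp [tradesWithin]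

theorem mem_tradesOf {i : I} {Ψ : Finset Ω} {ω : Ω} :
    ω ∈ M.tradesOf i Ψ ↔ ω ∈ Ψ ∧ (M.buyer ω = i ∨ M.seller ω = i) := by
  simp [tradesOf]

theorem mem_agents {i : I} {Ψ : Finset Ω} :
    i ∈ M.agents Ψ ↔ ∃ ω ∈ Ψ, M.buyer ω = i ∨ M.seller ω = i := by
  simp [agents]

theorem tradesOf_eq_empty {i : I} {Ψ : Finset Ω} (h : i ∉ M.agents Ψ) :
    M.tradesOf i Ψ = ∅ := by
  rw [Finset.eq_empty_iff_forall_notMem]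
  intro ω hω
  rw [mem_tradesOf] at hω
  exact h (M.mem_agents.2 ⟨ω, hω⟩)

theorem subset_tradesWithin_agents (Ψ : Finset Ω) : Ψ ⊆ M.tradesWithin (M.agents Ψ) := fun ω hω =>
  M.mem_tradesWithin.2 ⟨M.mem_agents.2 ⟨ω, hω, Or.inl rfl⟩, M.mem_agents.2 ⟨ω, hω, Or.inr rfl⟩⟩

theorem agents_subset {C : Finset I} {Ψ : Finset Ω} (h : Ψ ⊆ M.tradesWithin C) :
    M.agents Ψ ⊆ C := by
  intro i hi
  obtain ⟨ω, hω, h' | h'⟩ := M.mem_agents.1 hi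
  · exact h' ▸ (M.mem_tradesWithin.1 (h hω)).1
  · exact h' ▸ (M.mem_tradesWithin.1 (h hω)).2

theorem charFun_univ : M.charFun Finset.univ = M.marketValue := by
  have : M.tradesWithin Finset.univ = Finset.univ := by ext; simp [tradesWithin]
  rw [charFun, this, Finset.powerset_univ]
  rfl

theorem IsEfficient.feasible {M : TradingMarket I Ω} (hM : 0 < M.marketValue) {Φ : Finset Ω}
    (hΦ : M.IsEfficient Φ) (i : I) : M.val i (M.tradesOf i Φ) ≠ ⊥ := by
  intro h
  have : M.welfare Φ = ⊥ :=
    WithBot.sum_eq_bot_iff.2 ⟨i, Finset.mem_univ i, M.value_eq_bot_iff.2 h⟩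
  rw [IsEfficient] at hΦ
  rw [← hΦ, this] at hM
  exact not_lt_bot hM

theorem IsEfficient.marketValue_eq {M : TradingMarket I Ω} (hM : 0 < M.marketValue) {Φ : Finset Ω}
    (hΦ : M.IsEfficient Φ) :
    M.marketValue = ((∑ i, M.realVal i (M.tradesOf i Φ) : ℝ) : WithBot ℝ) := by
  rw [← M.sum_value_eq_coe fun i _ => hΦ.feasible hM i]
  exact hΦ.symm

theorem exists_isEfficient : ∃ Φ, M.IsEfficient Φ := by
  obtain ⟨Φ, -, h⟩ := Finset.exists_mem_eq_sup (Finset.univ : Finset (Finset Ω))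
    Finset.univ_nonempty M.welfare
  exact ⟨Φ, h.symm⟩

/-- The core of the cooperative market game in terms of real-valued valuations. -/
theorem mem_gameCore_iff (hM : 0 < M.marketValue) {Φ : Finset Ω} (hΦ : M.IsEfficient Φ)
    {x : I → ℝ} :
    x ∈ M.gameCore ↔ (∀ i, 0 ≤ x i) ∧ ∑ i, x i ≤ ∑ i, M.realVal i (M.tradesOf i Φ) ∧
      ∀ C : Finset I, ∀ Ψ ⊆ M.tradesWithin C, (∀ i ∈ C, M.val i (M.tradesOf i Ψ) ≠ ⊥) →
        ∑ i ∈ C, M.realVal i (M.tradesOf i Ψ) ≤ ∑ i ∈ C, x i := by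
  have hW := hΦ.marketValue_eq hM
  simp only [gameCore, Set.mem_ofPred_eq, M.charFun_univ, hW, WithBot.coe_inj]
  refine and_congr_right fun _ => ⟨fun ⟨h1, h2⟩ => ⟨h1.le, fun C => ?_⟩, fun ⟨h1, h2⟩ => ⟨?_, ?_⟩⟩
  · rw [← M.charFun_le_coe_iff]
    rcases eq_or_ne C Finset.univ with rfl | hC
    · rw [M.charFun_univ, hW, h1]
    · exact h2 C (Finset.ssubset_univ_iff.2 hC)
  -- The constraint of the grand coalition, tested on the efficient `Φ`, is the missing inequality.
  · refine le_antisymm h1 (h2 _ Φ (fun ω _ => ?_) fun i _ => hΦ.feasible hM i)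
    simp [mem_tradesWithin]
  · exact fun C _ => M.charFun_le_coe_iff.2 (h2 C)

/-! ### Essential agents from the game core -/

theorem exists_isEssential_of_gameCore_nonempty (hM : 0 < M.marketValue)
    (h : M.gameCore.Nonempty) : ∃ i, M.IsEssential i := by
  obtain ⟨x, hx⟩ := h
  by_contra! hne
  have hx0 : ∀ i, x i ≤ 0 := by
    intro i
    have := hne i
    rw [IsEssential] at this
    push Not at this
    obtain ⟨Φ, hΦ, hi⟩ := this
    obtain ⟨-, h1, h2⟩ := (M.mem_gameCore_iff hM hΦ).1 hx
    -- The efficient `Φ` avoids `i`, so it is available to the coalition of all other agents.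
    have h3 := h2 (Finset.univ.erase i) Φ (fun ω hω => M.mem_tradesWithin.2 ?_)
      fun j _ => hΦ.feasible hM j
    · rw [← Finset.add_sum_erase _ _ (Finset.mem_univ i),
        ← Finset.add_sum_erase _ _ (Finset.mem_univ i), M.tradesOf_eq_empty hi,
        M.realVal_empty] at h1
      linarith
    · have := M.mem_tradesWithin.1 (M.subset_tradesWithin_agents Φ hω)
      simp only [Finset.mem_erase, Finset.mem_univ, and_true]
      exact ⟨fun h => hi (h ▸ this.1), fun h => hi (h ▸ this.2)⟩
  have h1 : (0 : WithBot ℝ) < ((∑ i, x i : ℝ) : WithBot ℝ) := by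
    rw [hx.2.1, M.charFun_univ]
    exact hM
  have h2 : 0 < ∑ i, x i := by exact_mod_cast h1
  exact absurd (Finset.sum_nonpos fun i _ => hx0 i) (not_le.2 h2)

/-! ### Payments -/

theorem sign_eq (i : I) (ω : Ω) :
    M.sign i ω = (if M.buyer ω = i then 1 else 0) - (if M.seller ω = i then 1 else 0) := by
  have := M.buyer_ne_seller ω
  unfold sign
  split_ifs with h1 h2
  · exact absurd (h1.trans h2.symm) this
  all_goals norm_num

theorem sign_eq_zero {i : I} {ω : Ω} (h : ¬(M.buyer ω = i ∨ M.seller ω = i)) : M.sign i ω = 0 := by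
  push Not at h
  simp [sign, h.1, h.2]

theorem payment_tradesOf (i : I) (Ψ : Finset Ω) (q : Ω → ℝ) :
    M.payment i (M.tradesOf i Ψ) q = M.payment i Ψ q := by
  refine Finset.sum_subset (Finset.filter_subset _ _) fun ω hω h => ?_
  rw [M.sign_eq_zero fun h' => h (M.mem_tradesOf.2 ⟨hω, h'⟩), zero_mul]

/-- The total payment, trade by trade. -/
theorem sum_payment (Θ : I → Finset Ω) (P : I → Ω → ℝ) :
    ∑ i, M.payment i (Θ i) (P i) =
      ∑ ω, ((if ω ∈ Θ (M.buyer ω) then P (M.buyer ω) ω else 0) -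
        (if ω ∈ Θ (M.seller ω) then P (M.seller ω) ω else 0)) := by
  have h1 : ∀ i, M.payment i (Θ i) (P i) =
      ∑ ω, ((if M.buyer ω = i then if ω ∈ Θ i then P i ω else 0 else 0) -
        (if M.seller ω = i then if ω ∈ Θ i then P i ω else 0 else 0)) := by
    intro i
    rw [payment, ← Finset.sum_subset (Finset.subset_univ (Θ i))]
    · refine Finset.sum_congr rfl fun ω hω => ?_
      rw [M.sign_eq, if_pos hω]
      split_ifs <;> ring
    · intro ω _ hω
      simp [hω]
  simp only [h1]
  rw [Finset.sum_comm]
  refine Finset.sum_congr rfl fun ω _ => ?_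
  rw [Finset.sum_sub_distrib, Finset.sum_ite_eq, Finset.sum_ite_eq]
  simp

theorem sum_payment_const (Ψ : Finset Ω) (q : Ω → ℝ) : ∑ i, M.payment i Ψ q = 0 := by
  rw [M.sum_payment (fun _ => Ψ) fun _ => q]
  simp

theorem payment_eq_zero {i : I} {Ψ : Finset Ω} (h : i ∉ M.agents Ψ) (q : Ω → ℝ) :
    M.payment i Ψ q = 0 := by
  rw [← M.payment_tradesOf, M.tradesOf_eq_empty h]
  simp [payment]

theorem sum_payment_of_agents_subset {C : Finset I} {Ψ : Finset Ω} (h : M.agents Ψ ⊆ C)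
    (q : Ω → ℝ) : ∑ i ∈ C, M.payment i Ψ q = 0 := by
  rw [← M.sum_payment_const Ψ q]
  exact Finset.sum_subset (Finset.subset_univ _) fun i _ hi => M.payment_eq_zero (fun h' => hi (h h')) q

/-! ### Connected components of a set of trades -/

/-- Agents are connected if a chain of trades in `Ψ` links them. -/
def component (Ψ : Finset Ω) : Setoid I :=
  Relation.EqvGen.setoid fun a b => ∃ ω ∈ Ψ, M.buyer ω = a ∧ M.seller ω = b

theorem component_buyer_seller {Ψ : Finset Ω} {ω : Ω} (hω : ω ∈ Ψ) :
    (M.component Ψ) (M.buyer ω) (M.seller ω) :=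
  Relation.EqvGen.rel _ _ ⟨ω, hω, rfl, rfl⟩

theorem payment_add (i : I) (Ψ : Finset Ω) (p q : Ω → ℝ) :
    M.payment i Ψ (p + q) = M.payment i Ψ p + M.payment i Ψ q := by
  simp [payment, mul_add, Finset.sum_add_distrib]

theorem payment_smul (i : I) (Ψ : Finset Ω) (c : ℝ) (p : Ω → ℝ) :
    M.payment i Ψ (c • p) = c * M.payment i Ψ p := by
  simp only [payment, Finset.mul_sum, Pi.smul_apply, smul_eq_mul]
  exact Finset.sum_congr rfl fun _ _ => by ring

theorem payment_sum {ι : Type*} (s : Finset ι) (i : I) (Ψ : Finset Ω) (p : ι → Ω → ℝ) :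
    M.payment i Ψ (∑ k ∈ s, p k) = ∑ k ∈ s, M.payment i Ψ (p k) := by
  simp only [payment, Finset.sum_apply, Finset.mul_sum]
  exact Finset.sum_comm

/-- Prices can transfer one unit of money between connected agents. -/
theorem exists_unit_transfer {Ψ : Finset Ω} {a b : I} (h : (M.component Ψ) a b) :
    ∃ q : Ω → ℝ, ∀ j, M.payment j Ψ q =
      (if a = j then 1 else 0) - (if b = j then 1 else 0) := by
  induction h with
  | rel a b h =>
    obtain ⟨ω, hω, rfl, rfl⟩ := h
    refine ⟨Pi.single ω 1, fun j => ?_⟩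
    rw [← M.sign_eq, payment, Finset.sum_eq_single_of_mem ω hω]
    · simp
    · intro ω' _ hne
      simp [hne]
  | refl a => exact ⟨0, fun j => by simp [payment]⟩
  | symm a b _ ih =>
    obtain ⟨q, hq⟩ := ih
    refine ⟨(-1 : ℝ) • q, fun j => ?_⟩
    rw [M.payment_smul, hq]
    ring
  | trans a b c _ _ ih1 ih2 =>
    obtain ⟨q1, h1⟩ := ih1
    obtain ⟨q2, h2⟩ := ih2
    refine ⟨q1 + q2, fun j => ?_⟩
    rw [M.payment_add, h1, h2]
    ring

/-- Prices can collect the amounts `d k` at connected agents `ρ k`. -/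
theorem exists_transfer {Ψ : Finset Ω} {ρ : I → I} (hρ : ∀ k, (M.component Ψ) k (ρ k))
    (d : I → ℝ) :
    ∃ q : Ω → ℝ, ∀ j, M.payment j Ψ q = d j - ∑ k with ρ k = j, d k := by
  choose q hq using fun k => M.exists_unit_transfer (hρ k)
  refine ⟨∑ k, d k • q k, fun j => ?_⟩
  simp only [M.payment_sum, M.payment_smul, hq, mul_sub, Finset.sum_sub_distrib, mul_ite, mul_one,
    mul_zero, Finset.sum_filter]
  simp

/-- The trades of `Ψ` between agents connected to `r`. -/
def componentTrades (Ψ : Finset Ω) (r : I) : Finset Ω :=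
  open Classical in Ψ.filter fun ω => (M.component Ψ) (M.buyer ω) r

theorem mem_componentTrades {Ψ : Finset Ω} {r : I} {ω : Ω} :
    ω ∈ M.componentTrades Ψ r ↔ ω ∈ Ψ ∧ (M.component Ψ) (M.buyer ω) r := by
  simp [componentTrades]

theorem component_of_mem {Ψ : Finset Ω} {r j : I} {ω : Ω} (hω : ω ∈ M.componentTrades Ψ r)
    (hj : M.buyer ω = j ∨ M.seller ω = j) : (M.component Ψ) j r := by
  obtain ⟨h1, h2⟩ := M.mem_componentTrades.1 hω
  rcases hj with rfl | rfl
  · exact h2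
  · exact (M.component Ψ).trans ((M.component Ψ).symm (M.component_buyer_seller h1)) h2

theorem mem_componentTrades_of_component {Ψ : Finset Ω} {r j : I} {ω : Ω} (hω : ω ∈ Ψ)
    (hj : M.buyer ω = j ∨ M.seller ω = j) (h : (M.component Ψ) j r) :
    ω ∈ M.componentTrades Ψ r := by
  refine M.mem_componentTrades.2 ⟨hω, ?_⟩
  rcases hj with rfl | rfl
  · exact h
  · exact (M.component Ψ).trans (M.component_buyer_seller hω) h

theorem tradesOf_componentTrades {Ψ : Finset Ω} {r j : I} (h : (M.component Ψ) j r) :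
    M.tradesOf j (M.componentTrades Ψ r) = M.tradesOf j Ψ := by
  ext ω
  rw [mem_tradesOf, mem_tradesOf]
  exact and_congr_left fun hj => ⟨fun hω => (M.mem_componentTrades.1 hω).1,
    fun hω => M.mem_componentTrades_of_component hω hj h⟩

theorem mem_agents_componentTrades {Ψ : Finset Ω} {r j : I} :
    j ∈ M.agents (M.componentTrades Ψ r) ↔ j ∈ M.agents Ψ ∧ (M.component Ψ) j r := by
  rw [mem_agents, mem_agents]
  constructor
  · rintro ⟨ω, hω, hj⟩
    exact ⟨⟨ω, (M.mem_componentTrades.1 hω).1, hj⟩, M.component_of_mem hω hj⟩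
  · rintro ⟨⟨ω, hω, hj⟩, h⟩
    exact ⟨ω, M.mem_componentTrades_of_component hω hj h, hj⟩

/-! ### Outcomes -/

/-- The outcome in which the trades `Ψ` take place at the prices `q`. -/
def outcomeOf (Ψ : Finset Ω) (q : Ω → ℝ) : Outcome Ω :=
  ⟨Ψ, fun ω => q ω⟩

theorem exists_eq_outcomeOf (o : Outcome Ω) : ∃ q, o = outcomeOf o.trades q := by
  refine ⟨fun ω => if h : ω ∈ o.trades then o.price ⟨ω, h⟩ else 0, ?_⟩
  rcases o with ⟨Ψ, p⟩
  simp [outcomeOf]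

theorem outcomeUtility_outcomeOf (i : I) (Ψ : Finset Ω) (q : Ω → ℝ) :
    M.outcomeUtility i (outcomeOf Ψ q) =
      M.value i (M.tradesOf i Ψ) + ((-M.payment i Ψ q : ℝ) : WithBot ℝ) := by
  rw [outcomeUtility, payment, ← Finset.sum_coe_sort Ψ fun ω => M.sign i ω * q ω]
  rfl

theorem outcomeUtility_eq_coe {i : I} {Ψ : Finset Ω} (h : M.val i (M.tradesOf i Ψ) ≠ ⊥)
    (q : Ω → ℝ) : M.outcomeUtility i (outcomeOf Ψ q) =
      ((M.realVal i (M.tradesOf i Ψ) - M.payment i Ψ q : ℝ) : WithBot ℝ) := by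
  rw [M.outcomeUtility_outcomeOf, M.value_eq_coe h, ← WithBot.coe_add, sub_eq_add_neg]

theorem feasible_of_coe_le {i : I} {Ψ : Finset Ω} {q : Ω → ℝ} {x : ℝ}
    (h : (x : WithBot ℝ) ≤ M.outcomeUtility i (outcomeOf Ψ q)) :
    M.val i (M.tradesOf i Ψ) ≠ ⊥ := by
  intro h'
  rw [M.outcomeUtility_outcomeOf, M.value_eq_bot_iff.2 h', WithBot.bot_add] at h
  exact WithBot.not_coe_le_bot _ h

/-- The utilities of a core outcome form a game-core vector: a coalition that could do better would
have a connected component of trades with positive surplus, and prices on that component can hand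
all of it to one agent while leaving the others indifferent. -/
theorem gameCore_nonempty_of_outcomeCore_nonempty (hM : 0 < M.marketValue)
    (h : M.outcomeCore.Nonempty) : M.gameCore.Nonempty := by
  classical
  obtain ⟨o, hIR, hblock⟩ := h
  obtain ⟨p, hp⟩ := exists_eq_outcomeOf o
  generalize o.trades = Φ at hp
  subst hp
  obtain ⟨Φ₀, hΦ₀⟩ := M.exists_isEfficient
  have hf : ∀ i, M.val i (M.tradesOf i Φ) ≠ ⊥ := fun i => M.feasible_of_coe_le (x := 0) (hIR i)
  set x : I → ℝ := fun i => M.realVal i (M.tradesOf i Φ) - M.payment i Φ p with hx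
  have hu : ∀ i, M.outcomeUtility i (outcomeOf Φ p) = ((x i : ℝ) : WithBot ℝ) :=
    fun i => M.outcomeUtility_eq_coe (hf i) p
  have hx0 : ∀ i, 0 ≤ x i := by
    intro i
    have := hIR i
    rw [hu] at this
    exact_mod_cast this
  refine ⟨x, (M.mem_gameCore_iff hM hΦ₀).2 ⟨hx0, ?_, ?_⟩⟩
  · rw [hx, Finset.sum_sub_distrib, M.sum_payment_const, sub_zero, ← WithBot.coe_le_coe,
      ← hΦ₀.marketValue_eq hM, ← M.sum_value_eq_coe fun i _ => hf i]
    exact Finset.le_sup (f := M.welfare) (Finset.mem_univ Φ)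
  intro C Ψ hΨC hΨ
  by_contra! hlt
  set d : I → ℝ := fun j => M.realVal j (M.tradesOf j Ψ) - x j with hd
  have hA : 0 < ∑ j ∈ M.agents Ψ, d j := by
    refine lt_of_lt_of_le (?_ : 0 < ∑ j ∈ C, d j) ?_
    · rw [hd, Finset.sum_sub_distrib]
      linarith
    -- Members of `C` without a trade contribute `-x j ≤ 0`, so dropping them only increases the
    -- surplus.
    · rw [← Finset.sum_sdiff (M.agents_subset hΨC)]
      refine add_le_of_nonpos_left (Finset.sum_nonpos fun j hj => ?_)
      simp only [hd, M.tradesOf_eq_empty (Finset.mem_sdiff.1 hj).2, M.realVal_empty]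
      linarith [hx0 j]
  have hr : ∃ r ∈ M.agents Ψ, 0 < ∑ k ∈ M.agents Ψ with (M.component Ψ) k r, d k := by
    by_contra! hle
    refine absurd hA (not_lt.2 ?_)
    rw [← Finset.sum_fiberwise_of_maps_to
      (g := fun k => (Quotient.mk (M.component Ψ) k)) fun k hk => Finset.mem_image_of_mem _ hk]
    refine Finset.sum_nonpos fun c hc => ?_
    obtain ⟨r, hr, rfl⟩ := Finset.mem_image.1 hc
    simpa only [Quotient.eq] using hle r hr
  -- Every agent in the component of `r` pays its surplus `d` and `r` collects the total. In the
  -- other components each agent collects from itself, so nothing moves.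
  obtain ⟨r, hrA, hr⟩ := hr
  obtain ⟨q, hq⟩ := M.exists_transfer (Ψ := Ψ)
    (ρ := fun k => if (M.component Ψ) k r then r else k)
    (fun k => by
      split_ifs with h
      · exact h
      · exact (M.component Ψ).refl k)
    (fun k => if k ∈ M.agents Ψ then d k else 0)
  have hut : ∀ j ∈ M.agents (M.componentTrades Ψ r),
      M.outcomeUtility j (outcomeOf (M.componentTrades Ψ r) q) =
        ((x j + if j = r then ∑ k ∈ M.agents Ψ with (M.component Ψ) k r, d k else 0 : ℝ) :
          WithBot ℝ) := by
    intro j hj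
    obtain ⟨hjA, hjr⟩ := M.mem_agents_componentTrades.1 hj
    have hjt := M.tradesOf_componentTrades hjr
    rw [M.outcomeUtility_eq_coe (by rw [hjt]; exact hΨ j (M.agents_subset hΨC hjA)),
      ← M.payment_tradesOf, hjt, M.payment_tradesOf, hq, if_pos hjA]
    congr 1
    have : ∑ k with (if (M.component Ψ) k r then r else k) = j,
        (if k ∈ M.agents Ψ then d k else 0) =
          if j = r then ∑ k ∈ M.agents Ψ with (M.component Ψ) k r, d k else 0 := by
      rw [← Finset.sum_filter, Finset.filter_filter]
      split_ifs with h
      · subst h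
        refine Finset.sum_congr ?_ fun _ _ => rfl
        ext k
        simp only [Finset.mem_filter, Finset.mem_univ, true_and]
        constructor
        · rintro ⟨h1, h2⟩
          refine ⟨h2, ?_⟩
          by_contra h3
          rw [if_neg h3] at h1
          exact h3 (h1 ▸ hjr)
        · rintro ⟨h1, h2⟩
          exact ⟨if_pos h2, h1⟩
      · refine Finset.sum_eq_zero fun k hk => ?_
        obtain ⟨h1, -⟩ := (Finset.mem_filter.1 hk).2
        split_ifs at h1 with h2
        · exact absurd h1.symm h
        · exact absurd (h1 ▸ hjr) h2
    rw [this]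
    simp only [hd]
    ring
  refine hblock ⟨outcomeOf (M.componentTrades Ψ r) q, fun j hj => ?_, r, ?_, ?_⟩
  · rw [hut j hj, hu, WithBot.coe_le_coe]
    split_ifs
    · linarith
    · linarith
  · exact M.mem_agents_componentTrades.2 ⟨hrA, (M.component Ψ).refl r⟩
  · rw [hut r (M.mem_agents_componentTrades.2 ⟨hrA, (M.component Ψ).refl r⟩), hu,
      WithBot.coe_lt_coe, if_pos rfl]
    linarith

/-- Prices on an efficient set of trades implement a game-core vector `x`. A blocking outcome would
then give the agents involved in it a total above that of `x`; payments cancel among them, so their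
coalition constraint would fail. -/
theorem outcomeCore_nonempty_of_gameCore_nonempty (hM : 0 < M.marketValue)
    (h : M.gameCore.Nonempty) : M.outcomeCore.Nonempty := by
  classical
  obtain ⟨x, hx⟩ := h
  obtain ⟨Φ, hΦ⟩ := M.exists_isEfficient
  obtain ⟨hx0, hxW, hxC⟩ := (M.mem_gameCore_iff hM hΦ).1 hx
  have hf := hΦ.feasible hM
  set d : I → ℝ := fun j => M.realVal j (M.tradesOf j Φ) - x j with hd
  have hclass : ∀ r, ∑ k with (M.component Φ) k r, d k ≤ 0 := by
    intro r
    have hsub : M.componentTrades Φ r ⊆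
        M.tradesWithin (Finset.univ.filter fun k => (M.component Φ) k r) := by
      intro ω hω
      simp only [mem_tradesWithin, Finset.mem_filter, Finset.mem_univ, true_and]
      exact ⟨M.component_of_mem hω (Or.inl rfl), M.component_of_mem hω (Or.inr rfl)⟩
    have h := hxC _ _ hsub fun i hi => by
      rw [M.tradesOf_componentTrades (Finset.mem_filter.1 hi).2]
      exact hf i
    rw [Finset.sum_congr rfl fun i hi => by
      rw [M.tradesOf_componentTrades (Finset.mem_filter.1 hi).2]] at h
    rw [hd, Finset.sum_sub_distrib]
    linarith
  have hmk : ∀ c : Quotient (M.component Φ),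
      ∑ k with Quotient.mk (M.component Φ) k = c, d k ≤ 0 := by
    intro c
    induction c using Quotient.inductionOn with
    | h r => simpa only [Quotient.eq] using hclass r
  have htot : ∑ c : Quotient (M.component Φ),
      ∑ k with Quotient.mk (M.component Φ) k = c, d k = ∑ k, d k :=
    Finset.sum_fiberwise _ _ _
  -- No component has positive surplus, by its coalition constraint, and the total surplus is
  -- nonnegative; hence each one vanishes.
  have hzero : ∀ c : Quotient (M.component Φ),
      ∑ k with Quotient.mk (M.component Φ) k = c, d k = 0 := by
    have h0 : ∑ c : Quotient (M.component Φ),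
        ∑ k with Quotient.mk (M.component Φ) k = c, d k = 0 := by
      refine le_antisymm (Finset.sum_nonpos fun c _ => hmk c) ?_
      rw [htot, hd, Finset.sum_sub_distrib]
      linarith
    intro c
    exact (Finset.sum_eq_zero_iff_of_nonpos fun c _ => hmk c).1 h0 c (Finset.mem_univ c)
  obtain ⟨q, hq⟩ := M.exists_transfer (Ψ := Φ)
    (ρ := fun k => (Quotient.mk (M.component Φ) k).out)
    (fun k => (M.component Φ).symm (Quotient.mk_out k)) d
  have hq' : ∀ j, M.payment j Φ q = d j := by
    intro j
    rw [hq, sub_eq_self]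
    by_cases hj : (Quotient.mk (M.component Φ) j).out = j
    · rw [← hzero (Quotient.mk (M.component Φ) j)]
      refine Finset.sum_congr (Finset.filter_congr fun k _ => ?_) fun _ _ => rfl
      constructor
      · intro h
        rw [← h, Quotient.out_eq]
      · intro h
        rw [h, hj]
    · refine Finset.sum_eq_zero fun k hk => ?_
      have h := (Finset.mem_filter.1 hk).2
      exact absurd (by rw [← h, Quotient.out_eq]) hj
  have hu : ∀ i, M.outcomeUtility i (outcomeOf Φ q) = ((x i : ℝ) : WithBot ℝ) := by
    intro i
    rw [M.outcomeUtility_eq_coe (hf i), hq']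
    simp [hd]
  refine ⟨outcomeOf Φ q, fun i => ?_, ?_⟩
  · rw [hu]
    exact_mod_cast hx0 i
  rintro ⟨o, hle, i₀, hi₀, hlt⟩
  obtain ⟨p, hp⟩ := exists_eq_outcomeOf o
  generalize o.trades = Ψ at hp
  subst hp
  change ∀ i ∈ M.agents Ψ, _ at hle
  change i₀ ∈ M.agents Ψ at hi₀
  have hfΨ : ∀ i ∈ M.agents Ψ, M.val i (M.tradesOf i Ψ) ≠ ⊥ := by
    intro i hi
    have := hle i hi
    rw [hu] at this
    exact M.feasible_of_coe_le this
  have h1 := hxC _ Ψ (M.subset_tradesWithin_agents Ψ) hfΨ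
  have h2 : ∑ i ∈ M.agents Ψ, x i <
      ∑ i ∈ M.agents Ψ, (M.realVal i (M.tradesOf i Ψ) - M.payment i Ψ p) := by
    refine Finset.sum_lt_sum (fun i hi => ?_) ⟨i₀, hi₀, ?_⟩
    · have := hle i hi
      rwa [hu, M.outcomeUtility_eq_coe (hfΨ i hi), WithBot.coe_le_coe] at this
    · rwa [hu, M.outcomeUtility_eq_coe (hfΨ i₀ hi₀), WithBot.coe_lt_coe] at hlt
  rw [Finset.sum_sub_distrib, M.sum_payment_of_agents_subset subset_rfl] at h2
  linarith

/-! ### Demand -/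

theorem utility_le_iff {i : I} {Ψ Ψ' : Finset Ω} {p : Ω → ℝ} (hΨ : M.val i Ψ ≠ ⊥) :
    M.utility i Ψ' p ≤ M.utility i Ψ p ↔
      (M.val i Ψ' ≠ ⊥ →
        M.realVal i Ψ' - M.payment i Ψ' p ≤ M.realVal i Ψ - M.payment i Ψ p) := by
  unfold utility
  rw [M.value_eq_coe hΨ, ← WithBot.coe_add]
  by_cases h : M.val i Ψ' = ⊥
  · simp [h, M.value_eq_bot_iff.2 h]
  · rw [M.value_eq_coe h, ← WithBot.coe_add, WithBot.coe_le_coe]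
    simp only [ne_eq, h, not_false_eq_true, forall_const, sub_eq_add_neg, payment]

theorem mem_demand_iff {i : I} {Ψ : Finset Ω} {p : Ω → ℝ} :
    Ψ ∈ M.demand i p ↔ Ψ ⊆ M.tradesOf i Finset.univ ∧ M.val i Ψ ≠ ⊥ ∧
      ∀ Ψ' ⊆ M.tradesOf i Finset.univ, M.val i Ψ' ≠ ⊥ →
        M.realVal i Ψ' - M.payment i Ψ' p ≤ M.realVal i Ψ - M.payment i Ψ p := by
  refine and_congr_right fun _ => ⟨fun h => ?_, fun h Ψ' hΨ' => (M.utility_le_iff h.1).2 (h.2 Ψ' hΨ')⟩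
  have hΨ : M.val i Ψ ≠ ⊥ := by
    intro hb
    have h0 := h ∅ (Finset.empty_subset _)
    unfold utility at h0
    rw [M.value_eq_bot_iff.2 hb, WithBot.bot_add, M.value_eq_coe (M.val_empty_ne_bot i),
      ← WithBot.coe_add] at h0
    exact WithBot.not_coe_le_bot _ h0
  exact ⟨hΨ, fun Ψ' hΨ' => (M.utility_le_iff hΨ).1 (h Ψ' hΨ')⟩

theorem demand_nonneg {i : I} {Ψ : Finset Ω} {p : Ω → ℝ} (h : Ψ ∈ M.demand i p) :
    0 ≤ M.realVal i Ψ - M.payment i Ψ p := by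
  have := (M.mem_demand_iff.1 h).2.2 ∅ (Finset.empty_subset _) (M.val_empty_ne_bot i)
  simpa [M.realVal_empty, payment] using this

theorem demand_nonempty (i : I) (p : Ω → ℝ) : (M.demand i p).Nonempty := by
  classical
  obtain ⟨Ψ, hΨ, hmax⟩ := Finset.exists_max_image
    ((M.tradesOf i Finset.univ).powerset.filter fun Ψ => M.val i Ψ ≠ ⊥)
    (fun Ψ => M.realVal i Ψ - M.payment i Ψ p)
    ⟨∅, by simp [M.val_empty]⟩
  rw [Finset.mem_filter, Finset.mem_powerset] at hΨ
  exact ⟨Ψ, M.mem_demand_iff.2 ⟨hΨ.1, hΨ.2, fun Ψ' h1 h2 => hmax Ψ' (by simp [h1, h2])⟩⟩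

theorem payment_add_smul (i : I) (Ψ : Finset Ω) (c : ℝ) (p q : Ω → ℝ) :
    M.payment i Ψ (p + c • q) = M.payment i Ψ p + c * M.payment i Ψ q := by
  simp only [payment, Finset.mul_sum, Pi.smul_apply, smul_eq_mul, Pi.add_apply,
    ← Finset.sum_add_distrib]
  exact Finset.sum_congr rfl fun _ _ => by ring

/-- A small perturbation of the prices only breaks ties in the demand. -/
theorem eventually_demand_subset (i : I) (p q : Ω → ℝ) :
    ∀ᶠ c in nhds (0 : ℝ), M.demand i (p + c • q) ⊆ M.demand i p := by
  have key : ∀ Ψ Ψ' : Finset Ω, ∀ᶠ c in nhds (0 : ℝ),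
      M.realVal i Ψ - M.payment i Ψ p < M.realVal i Ψ' - M.payment i Ψ' p →
      M.realVal i Ψ - M.payment i Ψ (p + c • q) < M.realVal i Ψ' - M.payment i Ψ' (p + c • q) := by
    intro Ψ Ψ'
    simp only [M.payment_add_smul]
    by_cases h : M.realVal i Ψ - M.payment i Ψ p < M.realVal i Ψ' - M.payment i Ψ' p
    · have h1 : ContinuousAt (fun c : ℝ => M.realVal i Ψ -
          (M.payment i Ψ p + c * M.payment i Ψ q)) 0 := by fun_prop
      have h2 : ContinuousAt (fun c : ℝ => M.realVal i Ψ' -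
          (M.payment i Ψ' p + c * M.payment i Ψ' q)) 0 := by fun_prop
      filter_upwards [h1.eventually_lt h2 (by simpa using h)] with c hc _ using hc
    · exact Filter.Eventually.of_forall fun _ h' => absurd h' h
  have key' := Filter.eventually_all.2 fun Ψ => Filter.eventually_all.2 (key Ψ)
  filter_upwards [key'] with c hc Ψ hΨ
  obtain ⟨h1, h2, h3⟩ := M.mem_demand_iff.1 hΨ
  refine M.mem_demand_iff.2 ⟨h1, h2, fun Ψ' h4 h5 => ?_⟩
  by_contra! h
  exact absurd (h3 Ψ' h4 h5) (not_le.2 (hc Ψ Ψ' h))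

/-- Making the trades of `Ψ` more attractive, and the other ones less attractive, makes `Ψ` the
only demanded bundle. -/
theorem demand_eq_singleton {i : I} {Ψ : Finset Ω} {p : Ω → ℝ} (hΨ : Ψ ∈ M.demand i p) {c : ℝ}
    (hc : 0 < c) {Ξ : Finset Ω}
    (hΞ : Ξ ∈ M.demand i (p + c • fun ω => if ω ∈ Ψ then -M.sign i ω else M.sign i ω)) :
    Ξ = Ψ := by
  obtain ⟨h1, h2, h3⟩ := M.mem_demand_iff.1 hΨ
  obtain ⟨g1, g2, g3⟩ := M.mem_demand_iff.1 hΞ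
  -- The perturbation charges `Θ` the amount `|Θ \ Ψ| - |Θ ∩ Ψ|`, which is minimal only at `Θ = Ψ`.
  have hp : ∀ Θ ⊆ M.tradesOf i Finset.univ,
      M.payment i Θ (fun ω => if ω ∈ Ψ then -M.sign i ω else M.sign i ω) =
        ∑ ω ∈ Θ, if ω ∈ Ψ then -1 else 1 := by
    intro Θ hΘ
    refine Finset.sum_congr rfl fun ω hω => ?_
    have hs : M.sign i ω * M.sign i ω = 1 := by
      have := (M.mem_tradesOf.1 (hΘ hω)).2
      unfold sign
      split_ifs <;> simp_all
    dsimp only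
    split_ifs
    · rw [mul_neg, hs]
    · exact hs
  have h4 := h3 Ξ g1 g2
  have h5 := g3 Ψ h1 h2
  rw [M.payment_add_smul, M.payment_add_smul, hp _ h1, hp _ g1] at h5
  have h6 : (∑ ω ∈ Ξ, if ω ∈ Ψ then (-1 : ℝ) else 1) ≤ ∑ ω ∈ Ψ, if ω ∈ Ψ then (-1 : ℝ) else 1 := by
    refine le_of_mul_le_mul_left ?_ hc
    linarith
  have h7 : ∑ ω ∈ Ψ, (if ω ∈ Ψ then (-1 : ℝ) else 1) = ∑ ω ∈ Ψ, (-1 : ℝ) :=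
    Finset.sum_congr rfl fun ω hω => if_pos hω
  have h8 : ∑ ω ∈ Ξ \ Ψ, (if ω ∈ Ψ then (-1 : ℝ) else 1) = ∑ ω ∈ Ξ \ Ψ, (1 : ℝ) :=
    Finset.sum_congr rfl fun ω hω => if_neg (Finset.mem_sdiff.1 hω).2
  have h9 : ∑ ω ∈ Ξ ∩ Ψ, (if ω ∈ Ψ then (-1 : ℝ) else 1) = ∑ ω ∈ Ξ ∩ Ψ, (-1 : ℝ) :=
    Finset.sum_congr rfl fun ω hω => if_pos (Finset.mem_inter.1 hω).2
  rw [← Finset.sum_inter_add_sum_sdiff Ξ Ψ, h7, h8, h9] at h6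
  simp only [Finset.sum_const, nsmul_eq_mul, mul_neg, mul_one] at h6
  have h10 : (Ξ \ Ψ).card + Ψ.card ≤ (Ξ ∩ Ψ).card := by
    rify
    linarith
  have h11 : (Ξ ∩ Ψ).card ≤ Ψ.card := Finset.card_le_card Finset.inter_subset_right
  have h12 : Ξ ⊆ Ψ := Finset.sdiff_eq_empty_iff_subset.1 (Finset.card_eq_zero.1 (by omega))
  have h13 : Ξ ∩ Ψ = Ψ := Finset.eq_of_subset_of_card_le Finset.inter_subset_right (by omega)
  exact h12.antisymm (Finset.inter_eq_right.1 h13)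

/-- Raising the prices of trades in which `i` buys. -/
theorem FullySubstitutable.contraction {M : TradingMarket I Ω} {i : I}
    (h : M.FullySubstitutable i) {p p' : Ω → ℝ} (hs : ∀ ω, M.seller ω = i → p ω = p' ω)
    (hb : ∀ ω, M.buyer ω = i → p ω ≤ p' ω) {Ψ : Finset Ω} (hΨ : Ψ ∈ M.demand i p) :
    ∃ Ψ' ∈ M.demand i p', (∀ ω ∈ M.buying i Ψ, p ω = p' ω → ω ∈ M.buying i Ψ') ∧
      M.selling i Ψ' ⊆ M.selling i Ψ := by
  -- Condition (i) of full substitutability lowers prices, so it is applied backwards, from `p'` to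
  -- `p`. The bundle that it returns at `p` is not under control; the perturbation forces it to be
  -- `Ψ`, and small `c` keeps the bundle chosen near `p'` in the demand at `p'`.
  set η : Ω → ℝ := fun ω => if ω ∈ Ψ then -M.sign i ω else M.sign i ω with hη
  obtain ⟨c, hc, hc0⟩ := (((M.eventually_demand_subset i p' η).filter_mono
    (nhdsWithin_le_nhds (s := Set.Ioi 0))).and self_mem_nhdsWithin).exists
  obtain ⟨Ψ', hΨ'⟩ := M.demand_nonempty i (p' + c • η)
  obtain ⟨Ξ, hΞ, h1, h2⟩ := h.1 (p' + c • η) (p + c • η)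
    (fun ω hω => by simp [hs ω hω]) (fun ω hω => by simpa using hb ω hω) Ψ' hΨ'
  obtain rfl : Ξ = Ψ := M.demand_eq_singleton hΨ hc0 hΞ
  exact ⟨Ψ', hc hΨ', fun ω hω he => h1 ω hω (by simp [he]), h2⟩

/-! ### An ascending auction -/

/-- The prices that agent `i` faces: `b` counts the price increments of the buyers, `s` those of
the sellers. -/
def auctionPrice (N δ : ℝ) (b s : Ω → ℕ) (i : I) (ω : Ω) : ℝ :=
  -N + δ * if M.buyer ω = i then b ω else s ω

/-- The state of an auction in which the agent who faces the lower price provisionally holds the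
trade: a buyer executes the trades she holds, and a seller does not execute the ones he holds. -/
structure AuctionState (N δ : ℝ) (b s : Ω → ℕ) (Θ : I → Finset Ω) : Prop where
  close : ∀ ω, b ω ≤ s ω + 1 ∧ s ω ≤ b ω + 1
  unheld : ∀ ω, b ω = s ω → b ω = 0
  demand : ∀ i, Θ i ∈ M.demand i (M.auctionPrice N δ b s i)
  buyer_holds : ∀ ω, b ω < s ω → ω ∈ Θ (M.buyer ω)
  seller_holds : ∀ ω, s ω < b ω → ω ∉ Θ (M.seller ω)

variable {M}

/-- The buyer takes `ω₀` at her current price and the seller's price moves one increment above it.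
By condition (ii), a seller facing higher prices keeps his purchases and starts no sale other than
possibly `ω₀`, so all other holdings survive. -/
theorem AuctionState.exists_buyer_bid {N δ : ℝ} (hδ : 0 < δ) (hS : M.IsSubstitutes) {b s : Ω → ℕ}
    {Θ : I → Finset Ω} (h : M.AuctionState N δ b s Θ) {ω₀ : Ω} (h₀ : s ω₀ ≤ b ω₀)
    (hd : ω₀ ∈ Θ (M.buyer ω₀)) :
    ∃ Θ', M.AuctionState N δ b (Function.update s ω₀ (b ω₀ + 1)) Θ' := by
  have hex : ∀ i, ∃ Ψ' ∈ M.demand i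
      (M.auctionPrice N δ b (Function.update s ω₀ (b ω₀ + 1)) i),
      (∀ ω ∈ M.selling i Ψ', ω ≠ ω₀ → ω ∈ Θ i) ∧ M.buying i (Θ i) ⊆ M.buying i Ψ' := by
    intro i
    obtain ⟨Ψ', h1, h2, h3⟩ := (hS i).2 (M.auctionPrice N δ b s i)
      (M.auctionPrice N δ b (Function.update s ω₀ (b ω₀ + 1)) i)
      (fun ω hω => by simp [auctionPrice, hω])
      (fun ω hω => by
        have hne : M.buyer ω ≠ i := hω ▸ M.buyer_ne_seller ω
        simp only [auctionPrice, hne, if_false]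
        gcongr
        rcases eq_or_ne ω ω₀ with rfl | hne
        · simp only [Function.update_self]
          omega
        · simp [hne]) (Θ i) (h.demand i)
    refine ⟨Ψ', h1, fun ω hω hne => ?_, h3⟩
    exact (Finset.mem_filter.1 (h2 ω hω (by simp [auctionPrice, hne]))).1
  choose Θ' h1 h2 h3 using hex
  refine ⟨Θ', ⟨fun ω => ?_, fun ω => ?_, h1, fun ω hω => ?_, fun ω hω hmem => ?_⟩⟩
  · rcases eq_or_ne ω ω₀ with rfl | hne
    · simp only [Function.update_self]
      omega
    · simpa [hne] using h.close ω
  · rcases eq_or_ne ω ω₀ with rfl | hne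
    · simp
    · simpa [hne] using h.unheld ω
  · refine (Finset.mem_filter.1 (h3 _ (Finset.mem_filter.2 ⟨?_, rfl⟩))).1
    rcases eq_or_ne ω ω₀ with rfl | hne
    · exact hd
    · exact h.buyer_holds ω (by simpa [hne] using hω)
  · rcases eq_or_ne ω ω₀ with rfl | hne
    · simp only [Function.update_self] at hω
      omega
    · exact h.seller_holds ω (by simpa [hne] using hω)
        (h2 _ ω (Finset.mem_filter.2 ⟨hmem, rfl⟩) hne)

/-- The mirror image, with the buyer's price rising: by `FullySubstitutable.contraction` a buyer
keeps her purchases other than possibly `ω₀` and starts no new sale. -/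
theorem AuctionState.exists_seller_bid {N δ : ℝ} (hδ : 0 < δ) (hS : M.IsSubstitutes)
    {b s : Ω → ℕ} {Θ : I → Finset Ω} (h : M.AuctionState N δ b s Θ) {ω₀ : Ω} (h₀ : b ω₀ ≤ s ω₀)
    (hd : ω₀ ∉ Θ (M.seller ω₀)) :
    ∃ Θ', M.AuctionState N δ (Function.update b ω₀ (s ω₀ + 1)) s Θ' := by
  have hex : ∀ i, ∃ Ψ' ∈ M.demand i
      (M.auctionPrice N δ (Function.update b ω₀ (s ω₀ + 1)) s i),
      (∀ ω ∈ M.buying i (Θ i), ω ≠ ω₀ → ω ∈ Ψ') ∧ M.selling i Ψ' ⊆ M.selling i (Θ i) := by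
    intro i
    obtain ⟨Ψ', h1, h2, h3⟩ := (hS i).contraction (p := M.auctionPrice N δ b s i)
      (p' := M.auctionPrice N δ (Function.update b ω₀ (s ω₀ + 1)) s i)
      (fun ω hω => by
        have hne : M.buyer ω ≠ i := hω ▸ M.buyer_ne_seller ω
        simp [auctionPrice, hne])
      (fun ω hω => by
        simp only [auctionPrice, hω, if_true]
        gcongr
        rcases eq_or_ne ω ω₀ with rfl | hne
        · simp only [Function.update_self]
          omega
        · simp [hne]) (h.demand i)
    refine ⟨Ψ', h1, fun ω hω hne => ?_, h3⟩
    exact (Finset.mem_filter.1 (h2 ω hω (by simp [auctionPrice, hne]))).1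
  choose Θ' h1 h2 h3 using hex
  refine ⟨Θ', ⟨fun ω => ?_, fun ω => ?_, h1, fun ω hω => ?_, fun ω hω hmem => ?_⟩⟩
  · rcases eq_or_ne ω ω₀ with rfl | hne
    · simp only [Function.update_self]
      omega
    · simpa [hne] using h.close ω
  · rcases eq_or_ne ω ω₀ with rfl | hne
    · simp
    · simpa [hne] using h.unheld ω
  · rcases eq_or_ne ω ω₀ with rfl | hne
    · simp only [Function.update_self] at hω
      omega
    · exact h2 _ ω (Finset.mem_filter.2
        ⟨h.buyer_holds ω (by simpa [hne] using hω), rfl⟩) hne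
  · have hmem' := (Finset.mem_filter.1 (h3 _ (Finset.mem_filter.2 ⟨hmem, rfl⟩))).1
    rcases eq_or_ne ω ω₀ with rfl | hne
    · exact hd hmem'
    · exact h.seller_holds ω (by simpa [hne] using hω) hmem'

variable (M)

/-- A bound for the total value of all bundles. -/
def valueBound : ℝ :=
  ∑ i, ∑ Ψ : Finset Ω, |M.realVal i Ψ|

theorem sum_realVal_le_valueBound (Θ : I → Finset Ω) :
    ∑ i, M.realVal i (Θ i) ≤ M.valueBound :=
  Finset.sum_le_sum fun i _ => (le_abs_self _).trans
    (Finset.single_le_sum (f := fun Ψ => |M.realVal i Ψ|) (fun _ _ => abs_nonneg _)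
      (Finset.mem_univ (Θ i)))

theorem valueBound_nonneg : 0 ≤ M.valueBound :=
  Finset.sum_nonneg fun _ _ => Finset.sum_nonneg fun _ _ => abs_nonneg _

variable {M}

/-- The contribution of the trade `ω` to the total payment. -/
theorem AuctionState.sum_payment_eq {N δ : ℝ} (b s : Ω → ℕ) (Θ : I → Finset Ω) :
    ∑ i, M.payment i (Θ i) (M.auctionPrice N δ b s i) =
      ∑ ω, ((if ω ∈ Θ (M.buyer ω) then -N + δ * b ω else 0) -
        (if ω ∈ Θ (M.seller ω) then -N + δ * s ω else 0)) := by
  rw [M.sum_payment]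
  refine Finset.sum_congr rfl fun ω _ => ?_
  simp [auctionPrice, M.buyer_ne_seller ω]

/-- The price of a trade that both agents want to hold is bounded. -/
theorem AuctionState.price_le {N δ : ℝ} (hN : 0 ≤ N) (hδ : 0 < δ) {b s : Ω → ℕ}
    {Θ : I → Finset Ω} (h : M.AuctionState N δ b s Θ) {ω₀ : Ω} (hb : ω₀ ∈ Θ (M.buyer ω₀))
    (hs : ω₀ ∉ Θ (M.seller ω₀)) :
    δ * b ω₀ ≤ M.valueBound + (N + δ) * Fintype.card Ω := by
  have h0 : 0 ≤ ∑ i, (M.realVal i (Θ i) - M.payment i (Θ i) (M.auctionPrice N δ b s i)) :=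
    Finset.sum_nonneg fun i _ => M.demand_nonneg (h.demand i)
  rw [Finset.sum_sub_distrib, AuctionState.sum_payment_eq] at h0
  have h1 := M.sum_realVal_le_valueBound Θ
  -- Only the buyer executes `ω₀`, so its price is paid without being received; every other trade
  -- contributes at least `-(N + δ)`.
  have h2 : δ * b ω₀ - ∑ _ω : Ω, (N + δ) ≤
      ∑ ω, ((if ω ∈ Θ (M.buyer ω) then -N + δ * b ω else 0) -
        (if ω ∈ Θ (M.seller ω) then -N + δ * s ω else 0)) := by
    have h3 : δ * b ω₀ = ∑ ω, if ω = ω₀ then δ * b ω₀ else 0 := by simp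
    rw [h3, ← Finset.sum_sub_distrib]
    refine Finset.sum_le_sum fun ω _ => ?_
    rcases eq_or_ne ω ω₀ with rfl | hne
    · simp only [if_true, hb, hs, if_false]
      linarith
    · rw [if_neg hne]
      have hbn : 0 ≤ δ * b ω := by positivity
      have hsb : δ * s ω ≤ δ * b ω + δ := by
        have : (s ω : ℝ) ≤ b ω + 1 := by exact_mod_cast (h.close ω).2
        nlinarith
      split_ifs with h4 h5 h5
      · linarith
      · linarith
      -- A trade executed by its seller alone has no holder, so it is still at the initial price and
      -- contributes `N ≥ 0`.
      · have hz : s ω = 0 := by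
          have h6 : ¬ b ω < s ω := fun h' => h4 (h.buyer_holds ω h')
          have h7 : ¬ s ω < b ω := fun h' => h.seller_holds ω h' h5
          have := h.unheld ω
          omega
        rw [hz]
        push_cast
        linarith
      · linarith
  rw [Finset.sum_const, nsmul_eq_mul, Finset.card_univ] at h2
  nlinarith

/-- The auction ends, in a state in which nobody wants to bid. -/
theorem exists_terminal_auctionState (hS : M.IsSubstitutes) {N δ : ℝ} (hN : 0 ≤ N) (hδ : 0 < δ) :
    ∃ b s Θ, M.AuctionState N δ b s Θ ∧
      ∀ ω, (ω ∈ Θ (M.buyer ω) → b ω < s ω) ∧ (ω ∉ Θ (M.seller ω) → s ω < b ω) := by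
  obtain ⟨K, hK⟩ := exists_nat_gt ((M.valueBound + (N + δ) * Fintype.card Ω) / δ)
  rw [div_lt_iff₀ hδ] at hK
  -- The potential uses truncated subtraction; the cap `K + 1` on all counters makes each bid
  -- decrease it strictly.
  have step : ∀ n : ℕ, ∀ b s Θ, M.AuctionState N δ b s Θ → (∀ ω, b ω ≤ K + 1 ∧ s ω ≤ K + 1) →
      ∑ ω, ((K + 1 - b ω) + (K + 1 - s ω)) = n → ∃ b s Θ, M.AuctionState N δ b s Θ ∧
      ∀ ω, (ω ∈ Θ (M.buyer ω) → b ω < s ω) ∧ (ω ∉ Θ (M.seller ω) → s ω < b ω) := by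
    intro n
    induction n using Nat.strong_induction_on with
    | _ n ih =>
      intro b s Θ h hbs hn
      by_cases hb : ∃ ω, ω ∈ Θ (M.buyer ω) ∧ s ω ≤ b ω
      · obtain ⟨ω₀, hd, h₀⟩ := hb
        obtain ⟨Θ', h'⟩ := h.exists_buyer_bid hδ hS h₀ hd
        have hbK : b ω₀ ≤ K := by
          rcases h₀.eq_or_lt with he | hlt
          · have := h.unheld ω₀ he.symm
            omega
          · have h1 := h.price_le hN hδ hd (h.seller_holds ω₀ hlt)
            have h2 : δ * b ω₀ < δ * K := by linarith
            have h3 : (b ω₀ : ℝ) < K := lt_of_mul_lt_mul_left h2 hδ.le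
            exact_mod_cast h3.le
        refine ih _ ?_ b _ Θ' h' (fun ω => ⟨(hbs ω).1, ?_⟩) rfl
        · rw [← hn]
          refine Finset.sum_lt_sum (fun ω _ => ?_) ⟨ω₀, Finset.mem_univ _, ?_⟩
          · rcases eq_or_ne ω ω₀ with rfl | hne
            · simp only [Function.update_self]
              omega
            · simp [hne]
          · simp only [Function.update_self]
            omega
        · rcases eq_or_ne ω ω₀ with rfl | hne
          · simp only [Function.update_self]
            omega
          · simpa [hne] using (hbs ω).2
      by_cases hs : ∃ ω, ω ∉ Θ (M.seller ω) ∧ b ω ≤ s ω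
      · obtain ⟨ω₀, hd, h₀⟩ := hs
        obtain ⟨Θ', h'⟩ := h.exists_seller_bid hδ hS h₀ hd
        have hsK : s ω₀ ≤ K := by
          rcases h₀.eq_or_lt with he | hlt
          · have := h.unheld ω₀ he
            omega
          · have h1 := h.price_le hN hδ (h.buyer_holds ω₀ hlt) hd
            have h2 : δ * b ω₀ < δ * K := by linarith
            have h3 : (b ω₀ : ℝ) < K := lt_of_mul_lt_mul_left h2 hδ.le
            have h4 : b ω₀ < K := by exact_mod_cast h3
            have := (h.close ω₀).2
            omega
        refine ih _ ?_ _ s Θ' h' (fun ω => ⟨?_, (hbs ω).2⟩) rfl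
        · rw [← hn]
          refine Finset.sum_lt_sum (fun ω _ => ?_) ⟨ω₀, Finset.mem_univ _, ?_⟩
          · rcases eq_or_ne ω ω₀ with rfl | hne
            · simp only [Function.update_self]
              omega
            · simp [hne]
          · simp only [Function.update_self]
            omega
        · rcases eq_or_ne ω ω₀ with rfl | hne
          · simp only [Function.update_self]
            omega
          · simpa [hne] using (hbs ω).1
      push Not at hb hs
      exact ⟨b, s, Θ, h, fun ω => ⟨hb ω, hs ω⟩⟩
  choose Θ hΘ using fun i => M.demand_nonempty i (M.auctionPrice N δ 0 0 i)
  exact step _ 0 0 Θ ⟨by simp, by simp, hΘ, by simp, by simp⟩ (by simp) rfl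

/-! ### From approximate equilibria to the game core -/

/-- Approximate core utilities from an approximate competitive equilibrium. -/
theorem exists_approx_core (hS : M.IsSubstitutes) {Φ₀ : Finset Ω}
    (hΦ₀ : M.IsEfficient Φ₀) (hM : 0 < M.marketValue) {ε : ℝ} (hε : 0 < ε) :
    ∃ x : I → ℝ, (∀ i, 0 ≤ x i) ∧
      ∑ i, x i ≤ ∑ i, M.realVal i (M.tradesOf i Φ₀) + ε ∧
      ∀ C : Finset I, ∀ Ψ ⊆ M.tradesWithin C, (∀ i ∈ C, M.val i (M.tradesOf i Ψ) ≠ ⊥) →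
        ∑ i ∈ C, M.realVal i (M.tradesOf i Ψ) ≤ ∑ i ∈ C, x i + ε := by
  set δ : ℝ := ε / (Fintype.card Ω + 1) with hδdef
  have hcard : (0 : ℝ) < Fintype.card Ω + 1 := by positivity
  have hδ : 0 < δ := div_pos hε hcard
  have hδε : δ * Fintype.card Ω ≤ ε := by
    have : δ * (Fintype.card Ω + 1) = ε := div_mul_cancel₀ _ hcard.ne'
    linarith
  -- The start price `-N` is so low that a trade left without a holder would make the total utility
  -- negative.
  set N : ℝ := M.valueBound + ε + 1 with hNdef
  have hV := M.valueBound_nonneg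
  have hN : 0 ≤ N := by positivity
  obtain ⟨b, s, Θ, h, hterm⟩ := exists_terminal_auctionState hS hN hδ
  have hsub : ∀ i, Θ i ⊆ M.tradesOf i Finset.univ := fun i => (M.mem_demand_iff.1 (h.demand i)).1
  have hbuy : ∀ ω, ω ∈ Θ (M.buyer ω) ↔ b ω < s ω :=
    fun ω => ⟨(hterm ω).1, h.buyer_holds ω⟩
  have hsell : ∀ ω, ω ∈ Θ (M.seller ω) ↔ b ω ≤ s ω := fun ω =>
    ⟨fun h' => not_lt.1 fun h'' => h.seller_holds ω h'' h',
      fun h' => by_contra fun h'' => absurd ((hterm ω).2 h'') (not_lt.2 h')⟩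
  set x : I → ℝ := fun i => M.realVal i (Θ i) - M.payment i (Θ i) (M.auctionPrice N δ b s i)
    with hx
  have hx0 : ∀ i, 0 ≤ x i := fun i => M.demand_nonneg (h.demand i)
  -- At the end, both agents execute a trade with `b < s`, neither executes one with `s < b`, and a
  -- trade without holder is executed by its seller alone, who pays `N`.
  have hsum : ∑ i, x i ≤ ∑ i, M.realVal i (Θ i) +
      ∑ ω, (δ - if b ω = s ω then N else 0) := by
    rw [hx, Finset.sum_sub_distrib, AuctionState.sum_payment_eq, sub_eq_add_neg,
      ← Finset.sum_neg_distrib]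
    gcongr with ω
    simp only [hbuy, hsell]
    rcases lt_trichotomy (b ω) (s ω) with hlt | heq | hgt
    · have h1 : (s ω : ℝ) ≤ b ω + 1 := by exact_mod_cast (h.close ω).2
      simp only [hlt, hlt.le, hlt.ne, if_true, if_false]
      nlinarith
    · have h1 := h.unheld ω heq
      rw [← heq, h1]
      simp [hδ.le]
    · simp [hgt.not_gt, hgt.not_ge, hgt.ne', hδ.le]
  have hsplit : ∑ ω, (δ - if b ω = s ω then N else 0) =
      Fintype.card Ω * δ - ∑ ω, if b ω = s ω then N else 0 := by
    rw [Finset.sum_sub_distrib, Finset.sum_const, nsmul_eq_mul, Finset.card_univ]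
  rw [hsplit] at hsum
  have hheld : ∀ ω, b ω ≠ s ω := by
    intro ω₀ he
    have h1 : N ≤ ∑ ω, if b ω = s ω then N else 0 := by
      have := Finset.single_le_sum (f := fun ω => if b ω = s ω then N else 0)
        (fun ω _ => by split_ifs <;> linarith) (Finset.mem_univ ω₀)
      simpa [he] using this
    have h2 := M.sum_realVal_le_valueBound Θ
    have h3 : 0 ≤ ∑ i, x i := Finset.sum_nonneg fun i _ => hx0 i
    linarith
  set Φ : Finset Ω := Finset.univ.filter fun ω => b ω < s ω with hΦ
  have hΘ : ∀ i, Θ i = M.tradesOf i Φ := by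
    intro i
    ext ω
    rw [mem_tradesOf, hΦ, Finset.mem_filter]
    have hne := hheld ω
    constructor
    · intro hω
      have hi := (M.mem_tradesOf.1 (hsub i hω)).2
      refine ⟨⟨Finset.mem_univ _, ?_⟩, hi⟩
      rcases hi with rfl | rfl
      · exact (hbuy ω).1 hω
      · exact lt_of_le_of_ne ((hsell ω).1 hω) hne
    · rintro ⟨⟨-, hlt⟩, rfl | rfl⟩
      · exact (hbuy ω).2 hlt
      · exact (hsell ω).2 hlt.le
  refine ⟨x, hx0, ?_, fun C Ψ hΨC hΨ => ?_⟩
  · have hW : ∑ i, M.realVal i (Θ i) ≤ ∑ i, M.realVal i (M.tradesOf i Φ₀) := by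
      rw [← WithBot.coe_le_coe, ← hΦ₀.marketValue_eq hM,
        ← M.sum_value_eq_coe fun i _ => (M.mem_demand_iff.1 (h.demand i)).2.1]
      simp only [hΘ]
      exact Finset.le_sup (f := M.welfare) (Finset.mem_univ Φ)
    simp only [hheld, if_false, Finset.sum_const_zero, sub_zero] at hsum
    linarith
  · have h1 : ∑ i ∈ C, (M.realVal i (M.tradesOf i Ψ) -
        M.payment i (M.tradesOf i Ψ) (M.auctionPrice N δ b s i)) ≤ ∑ i ∈ C, x i :=
      Finset.sum_le_sum fun i hi => (M.mem_demand_iff.1 (h.demand i)).2.2 _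
        (Finset.filter_subset_filter _ (Finset.subset_univ _)) (hΨ i hi)
    have h2 : ∑ i ∈ C, M.payment i (M.tradesOf i Ψ) (M.auctionPrice N δ b s i) =
        ∑ i, M.payment i (M.tradesOf i Ψ) (M.auctionPrice N δ b s i) := by
      refine Finset.sum_subset (Finset.subset_univ _) fun i _ hi => ?_
      rw [M.payment_tradesOf]
      exact M.payment_eq_zero (fun h' => hi (M.agents_subset hΨC h')) _
    -- Buyer and seller face prices at most `δ` apart, so payments inside the coalition cancel up to
    -- `δ` per trade.
    have h3 : ∑ i, M.payment i (M.tradesOf i Ψ) (M.auctionPrice N δ b s i) ≤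
        ∑ _ω : Ω, δ := by
      rw [AuctionState.sum_payment_eq]
      refine Finset.sum_le_sum fun ω _ => ?_
      simp only [mem_tradesOf, true_or, or_true, and_true]
      have h4 : (b ω : ℝ) ≤ s ω + 1 := by exact_mod_cast (h.close ω).1
      split_ifs
      · nlinarith
      · linarith
    rw [Finset.sum_const, nsmul_eq_mul, Finset.card_univ] at h3
    rw [Finset.sum_sub_distrib, h2] at h1
    linarith

/-- The approximate core vectors with `ε = 1 / (n + 1)` lie in a compact box, and the core
inequalities are closed, so they pass to a subsequential limit. -/
theorem IsSubstitutes.gameCore_nonempty (hS : M.IsSubstitutes) (hM : 0 < M.marketValue) :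
    M.gameCore.Nonempty := by
  obtain ⟨Φ₀, hΦ₀⟩ := M.exists_isEfficient
  set W : ℝ := ∑ i, M.realVal i (M.tradesOf i Φ₀) with hW
  choose x hx0 hxW hxC using fun n : ℕ =>
    exists_approx_core hS hΦ₀ hM (Nat.one_div_pos_of_nat (α := ℝ) (n := n))
  have hbox : ∀ n, x n ∈ Set.Icc (0 : I → ℝ) fun _ => W + 1 := by
    refine fun n => ⟨fun i => hx0 n i, fun i => ?_⟩
    have h1 := Finset.single_le_sum (fun j _ => hx0 n j) (Finset.mem_univ i)
    have h2 : (1 : ℝ) / (n + 1) ≤ 1 := by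
      rw [div_le_one (by positivity)]
      linarith [Nat.cast_nonneg (α := ℝ) n]
    have h3 := hxW n
    dsimp only
    linarith
  obtain ⟨y, -, φ, hφ, hy⟩ := isCompact_Icc.tendsto_subseq hbox
  have hyi : ∀ i, Filter.Tendsto (fun n => x (φ n) i) Filter.atTop (nhds (y i)) :=
    fun i => (tendsto_pi_nhds.1 hy) i
  have hε : Filter.Tendsto (fun n => (1 : ℝ) / ((φ n : ℕ) + 1)) Filter.atTop (nhds 0) :=
    tendsto_one_div_add_atTop_nhds_zero_nat.comp hφ.tendsto_atTop
  have hsumC : ∀ C : Finset I, Filter.Tendsto (fun n => ∑ i ∈ C, x (φ n) i) Filter.atTop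
      (nhds (∑ i ∈ C, y i)) := fun C => tendsto_finsetSum C fun i _ => hyi i
  refine ⟨y, (M.mem_gameCore_iff hM hΦ₀).2 ⟨fun i => ?_, ?_, fun C Ψ hΨC hΨ => ?_⟩⟩
  · exact ge_of_tendsto' (hyi i) fun n => hx0 _ i
  · have := le_of_tendsto_of_tendsto' (hsumC Finset.univ) (hε.const_add W) fun n => hxW (φ n)
    simpa using this
  · have := ge_of_tendsto' ((hsumC C).add hε) fun n => hxC (φ n) C Ψ hΨC hΨ
    simpa using this

end

end TradingMarket

theorem mainTheorem11 {I Ω : Type*} [Fintype I] [DecidableEq I] [Fintype Ω] [DecidableEq Ω]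
    (M : TradingMarket I Ω) (hM : 0 < M.marketValue) :
    (M.gameCore.Nonempty → ∃ i, M.IsEssential i) ∧
    (M.outcomeCore.Nonempty → ∃ i, M.IsEssential i) ∧
    (M.IsSubstitutes → M.gameCore.Nonempty ∧ M.outcomeCore.Nonempty ∧ ∃ i, M.IsEssential i) := by
  have hess := M.exists_isEssential_of_gameCore_nonempty hM
  refine ⟨hess, fun h => hess (M.gameCore_nonempty_of_outcomeCore_nonempty hM h), fun hS => ?_⟩
  have h := hS.gameCore_nonempty hM
  exact ⟨h, M.outcomeCore_nonempty_of_gameCore_nonempty hM h, hess h⟩
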